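/- Let $N\ge 2$ be an integer, let $m\ge 1$ be an odd integer, and let $q\in\mathbb{C}$ be a primitive $m$th root of unity. Let $F_q(N)$ be the unital associative $\mathbb{C}$-algebra generated by $z_0,\dots,z_{N-1},z_0^*,\dots,z_{N-1}^*$ subject to the relations $$z_iz_j=q^{-1}z_jz_i\ (i<j),\qquad z_i^*z_j^*=q\,z_j^*z_i^*\ (i<j),\qquad z_iz_j^*=q^{-1}z_j^*z_i\ (i\ne j),$$ $$z_iz_i^*-z_i^*z_i=(q^2-1)\sum_{k>i}z_kz_k^*\quad(0\le i\le N-1).$$ Then the center of $F_q(N)$ is equal to the unital $\mathbb{C}$-subalgebra generated by the following elements: $\Omega=\sum_{k=0}^{N-1}z_kz_k^*$; the powers $z_i^m$ and $(z_i^*)^m$ for $i=0,1,\dots,N-1$; and the products $z_{N-1}^a(z_{N-1}^*)^b$ with $a,b\in\{1,2,\dots,m-1\}$ and $a+b=m$. -/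

import Mathlib

namespace QuantizedHeisenberg

/-- Names of the `2N` generators: `z i` stands for `z_i` and `zs i` for `z_i^*`,
where `i = 0, 1, …, N - 1`. -/
inductive Gen (N : ℕ) : Type
  | z (i : Fin N) : Gen N
  | zs (i : Fin N) : Gen N

/-- The free letter `z_i`. -/
abbrev freeZ {N : ℕ} (i : Fin N) : FreeAlgebra ℂ (Gen N) := FreeAlgebra.ι ℂ (Gen.z i)

/-- The free letter `z_i^*`. -/
abbrev freeZs {N : ℕ} (i : Fin N) : FreeAlgebra ℂ (Gen N) := FreeAlgebra.ι ℂ (Gen.zs i)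

/-- The defining relations of `F_q(N)`. -/
inductive Rel (q : ℂ) (N : ℕ) : FreeAlgebra ℂ (Gen N) → FreeAlgebra ℂ (Gen N) → Prop
  | z_z (i j : Fin N) (h : i < j) :
      Rel q N (freeZ i * freeZ j) (q⁻¹ • (freeZ j * freeZ i))
  | zs_zs (i j : Fin N) (h : i < j) :
      Rel q N (freeZs i * freeZs j) (q • (freeZs j * freeZs i))
  | z_zs (i j : Fin N) (h : i ≠ j) :
      Rel q N (freeZ i * freeZs j) (q⁻¹ • (freeZs j * freeZ i))
  | z_zs_self (i : Fin N) :
      Rel q N (freeZ i * freeZs i - freeZs i * freeZ i)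
        ((q ^ 2 - 1) • ∑ k ∈ Finset.Ioi i, freeZ k * freeZs k)

/-- The quantum function algebra `F_q(N)`: the unital associative `ℂ`-algebra with generators
`z_i`, `z_i^*` and the relations `Rel q N`, for a nonzero complex parameter `q`. -/
abbrev Fq (q : ℂ) (N : ℕ) : Type := RingQuot (Rel q N)

/-- The generator `z_i` of `F_q(N)`. -/
noncomputable def z (q : ℂ) {N : ℕ} (i : Fin N) : Fq q N :=
  RingQuot.mkAlgHom ℂ (Rel q N) (freeZ i)

/-- The generator `z_i^*` of `F_q(N)`. -/
noncomputable def zs (q : ℂ) {N : ℕ} (i : Fin N) : Fq q N :=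
  RingQuot.mkAlgHom ℂ (Rel q N) (freeZs i)

/-- The element `Ω = ∑_k z_k z_k^*`. -/
noncomputable def Omega (q : ℂ) (N : ℕ) : Fq q N := ∑ k : Fin N, z q k * zs q k

end QuantizedHeisenberg

namespace QuantizedHeisenberg

section QCommute

variable {A : Type*} [Ring A] [Algebra ℂ A] {a b w : A} {c c' : ℂ}

/-- `a` and `b` commute up to the scalar `c`. -/
def QCommute (c : ℂ) (a b : A) : Prop := a * b = c • (b * a)

theorem QCommute.symm (h : QCommute c a b) (hc : c ≠ 0) : QCommute c⁻¹ b a := by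
  unfold QCommute at *
  rw [h, smul_smul, inv_mul_cancel₀ hc, one_smul]

theorem QCommute.mul_left (ha : QCommute c a w) (hb : QCommute c' b w) :
    QCommute (c * c') (a * b) w := by
  unfold QCommute at *
  rw [mul_assoc, hb, mul_smul_comm, ← mul_assoc, ha, smul_mul_assoc, smul_smul, mul_assoc,
    mul_comm c]

theorem QCommute.mul_right (ha : QCommute c w a) (hb : QCommute c' w b) :
    QCommute (c * c') w (a * b) := by
  unfold QCommute at *
  rw [← mul_assoc, ha, smul_mul_assoc, mul_assoc, hb, mul_smul_comm, smul_smul, mul_assoc]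

theorem QCommute.one_left (w : A) : QCommute 1 1 w := by
  simp [QCommute]

theorem QCommute.one_right (w : A) : QCommute 1 w 1 := by
  simp [QCommute]

theorem qcommute_one_iff : QCommute 1 a b ↔ Commute a b := by
  simp [QCommute, Commute, SemiconjBy]

theorem QCommute.pow_left (h : QCommute c a w) (n : ℕ) : QCommute (c ^ n) (a ^ n) w := by
  induction n with
  | zero => simpa using QCommute.one_left w
  | succ n ih => simpa only [pow_succ] using ih.mul_left h

theorem QCommute.pow_right (h : QCommute c w a) (n : ℕ) : QCommute (c ^ n) w (a ^ n) := by
  induction n with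
  | zero => simpa using QCommute.one_right w
  | succ n ih => simpa only [pow_succ] using ih.mul_right h

theorem QCommute.sum_left {ι : Type*} {s : Finset ι} {f : ι → A}
    (h : ∀ i ∈ s, QCommute c (f i) w) : QCommute c (∑ i ∈ s, f i) w := by
  unfold QCommute at *
  rw [Finset.sum_mul, Finset.mul_sum, Finset.smul_sum]
  exact Finset.sum_congr rfl h

theorem QCommute.list_prod_left {ι : Type*} (l : List ι) (f : ι → A) (c : ι → ℂ)
    (h : ∀ i ∈ l, QCommute (c i) (f i) w) :
    QCommute (l.map c).prod (l.map f).prod w := by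
  induction l with
  | nil => simpa using QCommute.one_left w
  | cons i l ih =>
    simp only [List.map_cons, List.prod_cons]
    exact (h i (by simp)).mul_left (ih fun k hk => h k (by simp [hk]))

/-- Moving one factor of an ordered product to the front, up to a scalar. -/
theorem list_prod_eq_smul_mul_update {ι : Type*} [DecidableEq ι] (H : Submonoid ℂ) (j : ι)
    (f : ι → A) (h : ∀ k, k ≠ j → ∃ c ∈ H, QCommute c (f k) (f j)) (l : List ι) (hl : l.Nodup)
    (hj : j ∈ l) :
    ∃ c ∈ H, (l.map f).prod = c • (f j * (l.map (Function.update f j 1)).prod) := by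
  induction l with
  | nil => simp at hj
  | cons k l ih =>
    rw [List.nodup_cons] at hl
    rcases eq_or_ne k j with rfl | hkj
    · refine ⟨1, H.one_mem, ?_⟩
      have : l.map (Function.update f k 1) = l.map f := by
        refine List.map_congr_left fun i hi => Function.update_of_ne ?_ _ _
        rintro rfl; exact hl.1 hi
      simp [this]
    · have hjl : j ∈ l := by
        rcases List.mem_cons.1 hj with h | h
        · exact absurd h.symm hkj
        · exact h
      obtain ⟨c, hc, hp⟩ := ih hl.2 hjl
      obtain ⟨c', hc', hq⟩ := h k hkj
      refine ⟨c * c', H.mul_mem hc hc', ?_⟩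
      simp only [List.map_cons, List.prod_cons, hp, Function.update_of_ne hkj]
      unfold QCommute at hq
      rw [mul_smul_comm, ← mul_assoc, hq, smul_mul_assoc, smul_smul, mul_assoc]

end QCommute

section Relations

variable {N : ℕ} {q : ℂ}

theorem z_qcommute_z {i j : Fin N} (h : i < j) : QCommute q⁻¹ (z q i) (z q j) := by
  have := RingQuot.mkAlgHom_rel ℂ (Rel.z_z (q := q) i j h)
  rw [map_mul, map_smul, map_mul] at this
  exact this

theorem zs_qcommute_zs {i j : Fin N} (h : i < j) : QCommute q (zs q i) (zs q j) := by
  have := RingQuot.mkAlgHom_rel ℂ (Rel.zs_zs (q := q) i j h)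
  rw [map_mul, map_smul, map_mul] at this
  exact this

theorem z_qcommute_zs {i j : Fin N} (h : i ≠ j) : QCommute q⁻¹ (z q i) (zs q j) := by
  have := RingQuot.mkAlgHom_rel ℂ (Rel.z_zs (q := q) i j h)
  rw [map_mul, map_smul, map_mul] at this
  exact this

theorem z_qcommute_z' (hq : q ≠ 0) {i j : Fin N} (h : j < i) : QCommute q (z q i) (z q j) := by
  simpa using (z_qcommute_z h).symm (inv_ne_zero hq)

theorem zs_qcommute_zs' (hq : q ≠ 0) {i j : Fin N} (h : j < i) :
    QCommute q⁻¹ (zs q i) (zs q j) :=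
  (zs_qcommute_zs h).symm hq

theorem zs_qcommute_z (hq : q ≠ 0) {i j : Fin N} (h : i ≠ j) : QCommute q (zs q i) (z q j) := by
  simpa using (z_qcommute_zs h.symm).symm (inv_ne_zero hq)

variable (q) in
/-- The partial sums `∑_{k ≥ i} z_k z_k^*`. -/
noncomputable def partialOmega (N i : ℕ) : Fq q N :=
  ∑ k : Fin N with i ≤ k.val, z q k * zs q k

@[to_additive]
theorem prod_filter_le_eq_mul {A : Type*} [CommMonoid A] (f : Fin N → A) (j : Fin N) :
    ∏ k : Fin N with j.val ≤ k.val, f k = f j * ∏ k : Fin N with j.val + 1 ≤ k.val, f k := by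
  rw [← Finset.prod_insert (by simp)]
  congr 1
  ext k
  simp only [Finset.mem_filter, Finset.mem_univ, true_and, Finset.mem_insert, Fin.ext_iff]
  omega

@[to_additive]
theorem prod_filter_lt_succ {A : Type*} [CommMonoid A] (f : Fin N → A) (j : Fin N) :
    ∏ k : Fin N with k.val < j.val + 1, f k = f j * ∏ k : Fin N with k.val < j.val, f k := by
  rw [← Finset.prod_insert (by simp)]
  congr 1
  ext k
  simp only [Finset.mem_filter, Finset.mem_univ, true_and, Finset.mem_insert, Fin.ext_iff]
  omega

theorem sum_filter_le_sub {A : Type*} [AddCommGroup A] (f : ℕ → A) (hf : f N = 0) (i : ℕ)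
    (hi : i ≤ N) : ∑ k : Fin N with i ≤ k.val, (f k.val - f (k.val + 1)) = f i := by
  induction hi using Nat.decreasingInduction with
  | self =>
    rw [hf]
    refine Finset.sum_eq_zero fun k hk => ?_
    have := (Finset.mem_filter.1 hk).2
    omega
  | of_succ k hk ih =>
    rw [sum_filter_le_eq_add (fun k : Fin N => f k.val - f (k.val + 1)) ⟨k, hk⟩, ih]
    simp

theorem partialOmega_zero : partialOmega q N 0 = Omega q N := by
  simp [partialOmega, Omega]

theorem partialOmega_self : partialOmega q N N = 0 :=
  Finset.sum_eq_zero fun k hk => by have := (Finset.mem_filter.1 hk).2; omega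

theorem partialOmega_eq_add (j : Fin N) :
    partialOmega q N j = z q j * zs q j + partialOmega q N (j + 1) :=
  sum_filter_le_eq_add (fun k => z q k * zs q k) j

theorem z_mul_zs (j : Fin N) :
    z q j * zs q j = partialOmega q N j - partialOmega q N (j + 1) := by
  rw [partialOmega_eq_add, add_sub_cancel_right]

theorem zs_mul_z (j : Fin N) :
    zs q j * z q j = partialOmega q N j - q ^ 2 • partialOmega q N (j + 1) := by
  have := RingQuot.mkAlgHom_rel ℂ (Rel.z_zs_self (q := q) j)
  simp only [map_sub, map_mul, map_smul, map_sum] at this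
  change z q j * zs q j - zs q j * z q j =
    (q ^ 2 - 1) • ∑ k ∈ Finset.Ioi j, z q k * zs q k at this
  have h2 : ∑ k ∈ Finset.Ioi j, z q k * zs q k = partialOmega q N (j + 1) := by
    refine Finset.sum_congr ?_ fun _ _ => rfl
    ext k
    rw [Finset.mem_Ioi, Finset.mem_filter, Fin.lt_def, Nat.succ_le_iff]
    simp
  rw [h2] at this
  rw [partialOmega_eq_add, ← sub_eq_zero]
  have h3 := sub_eq_zero.2 this
  rw [← neg_eq_zero, ← h3]
  module

theorem partialOmega_qcommute_z (hq : q ≠ 0) {i : ℕ} {j : Fin N} (h : j.val < i) :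
    QCommute (q ^ 2) (partialOmega q N i) (z q j) := by
  refine QCommute.sum_left fun k hk => ?_
  have hk := (Finset.mem_filter.1 hk).2
  have hjk : j < k := Fin.lt_def.2 (by omega)
  rw [pow_two]
  exact (z_qcommute_z' hq hjk).mul_left (zs_qcommute_z hq hjk.ne')

theorem partialOmega_qcommute_zs (hq : q ≠ 0) {i : ℕ} {j : Fin N} (h : j.val < i) :
    QCommute (q⁻¹ ^ 2) (partialOmega q N i) (zs q j) := by
  refine QCommute.sum_left fun k hk => ?_
  have hk := (Finset.mem_filter.1 hk).2
  have hjk : j < k := Fin.lt_def.2 (by omega)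
  rw [pow_two]
  exact (z_qcommute_zs hjk.ne').mul_left (zs_qcommute_zs' hq hjk)

theorem partialOmega_self_commute_z (hq : q ≠ 0) (j : Fin N) :
    Commute (partialOmega q N j) (z q j) := by
  have h := partialOmega_qcommute_z hq (Nat.lt_succ_self j.val)
  have h1 := zs_mul_z (q := q) j
  unfold QCommute at h
  unfold Commute SemiconjBy
  rw [Nat.succ_eq_add_one] at h
  conv_lhs => rw [partialOmega_eq_add]
  rw [add_mul, mul_assoc, h1, mul_sub, mul_smul_comm, h]
  abel

theorem partialOmega_self_commute_zs (hq : q ≠ 0) (j : Fin N) :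
    Commute (partialOmega q N j) (zs q j) := by
  have h := (partialOmega_qcommute_zs hq (Nat.lt_succ_self j.val)).symm
    (pow_ne_zero _ (inv_ne_zero hq))
  have h1 := zs_mul_z (q := q) j
  unfold QCommute at h
  unfold Commute SemiconjBy
  rw [Nat.succ_eq_add_one, ← inv_pow, inv_inv] at h
  conv_rhs => rw [partialOmega_eq_add]
  rw [mul_add, ← mul_assoc, h1, sub_mul, smul_mul_assoc, h]
  abel

theorem partialOmega_eq_sum_add (i : ℕ) (j : Fin N) (h : i ≤ j.val) :
    partialOmega q N i =
      (∑ k : Fin N with i ≤ k.val ∧ k.val < j.val, z q k * zs q k) + partialOmega q N j := by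
  unfold partialOmega
  rw [← Finset.sum_union]
  · congr 1
    ext k
    simp only [Finset.mem_filter, Finset.mem_univ, true_and, Finset.mem_union]
    omega
  · rw [Finset.disjoint_filter]
    intro k _
    omega

theorem partialOmega_commute_z (hq : q ≠ 0) {i : ℕ} {j : Fin N} (h : i ≤ j.val) :
    Commute (partialOmega q N i) (z q j) := by
  rw [partialOmega_eq_sum_add i j h]
  refine Commute.add_left ?_ (partialOmega_self_commute_z hq j)
  refine Commute.sum_left _ _ _ fun k hk => ?_
  have hk := (Finset.mem_filter.1 hk).2
  have hjk : k < j := Fin.lt_def.2 (by omega)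
  rw [← qcommute_one_iff, ← inv_mul_cancel₀ hq]
  exact (z_qcommute_z hjk).mul_left (zs_qcommute_z hq hjk.ne)

theorem partialOmega_commute_zs (hq : q ≠ 0) {i : ℕ} {j : Fin N} (h : i ≤ j.val) :
    Commute (partialOmega q N i) (zs q j) := by
  rw [partialOmega_eq_sum_add i j h]
  refine Commute.add_left ?_ (partialOmega_self_commute_zs hq j)
  refine Commute.sum_left _ _ _ fun k hk => ?_
  have hk := (Finset.mem_filter.1 hk).2
  have hjk : k < j := Fin.lt_def.2 (by omega)
  rw [← qcommute_one_iff, ← inv_mul_cancel₀ hq]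
  exact (z_qcommute_zs hjk.ne).mul_left (zs_qcommute_zs hjk)

theorem partialOmega_commute (hq : q ≠ 0) (i j : ℕ) :
    Commute (partialOmega q N i) (partialOmega q N j) := by
  wlog h : i ≤ j generalizing i j
  · exact (this j i (by omega)).symm
  refine Commute.sum_right _ _ _ fun k hk => ?_
  have hk := (Finset.mem_filter.1 hk).2
  exact (partialOmega_commute_z hq (by omega)).mul_right (partialOmega_commute_zs hq (by omega))

theorem adjoin_generators :
    Algebra.adjoin ℂ (Set.range (z q (N := N)) ∪ Set.range (zs q (N := N))) = ⊤ := by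
  refine eq_top_iff.2 fun x _ => ?_
  obtain ⟨y, rfl⟩ := RingQuot.mkAlgHom_surjective ℂ (Rel q N) x
  induction y using FreeAlgebra.induction with
  | grade0 r =>
    rw [AlgHom.commutes]
    exact Subalgebra.algebraMap_mem _ _
  | grade1 g =>
    refine Algebra.subset_adjoin ?_
    cases g with
    | z i => exact Or.inl ⟨i, rfl⟩
    | zs i => exact Or.inr ⟨i, rfl⟩
  | mul a b ha hb =>
    rw [map_mul]
    exact mul_mem (ha trivial) (hb trivial)
  | add a b ha hb =>
    rw [map_add]
    exact add_mem (ha trivial) (hb trivial)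

theorem mem_center_of_commute {x : Fq q N} (hz : ∀ i, Commute x (z q i))
    (hzs : ∀ i, Commute x (zs q i)) : x ∈ Subalgebra.center ℂ (Fq q N) := by
  rw [Subalgebra.mem_center_iff]
  intro y
  have hy : y ∈ Algebra.adjoin ℂ (Set.range (z q (N := N)) ∪ Set.range (zs q (N := N))) := by
    rw [adjoin_generators]; trivial
  induction hy using Algebra.adjoin_induction with
  | mem y hy =>
    rcases hy with ⟨i, rfl⟩ | ⟨i, rfl⟩
    · exact (hz i).symm.eq
    · exact (hzs i).symm.eq
  | algebraMap r => exact Algebra.commutes r x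
  | add a b _ _ ha hb => rw [add_mul, mul_add, ha, hb]
  | mul a b _ _ ha hb => rw [mul_assoc, hb, ← mul_assoc, ha, mul_assoc]

theorem z_pow_mul_zs (hq : q ≠ 0) (j : Fin N) (n : ℕ) :
    z q j ^ (n + 1) * zs q j = partialOmega q N j * z q j ^ n -
      (q⁻¹ ^ 2) ^ n • (partialOmega q N (j + 1) * z q j ^ n) := by
  have h := (partialOmega_qcommute_z hq (Nat.lt_succ_self j.val)).symm (pow_ne_zero _ hq)
  have h2 := h.pow_left n
  unfold QCommute at h2
  rw [← inv_pow] at h2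
  rw [pow_succ, mul_assoc, z_mul_zs, mul_sub, h2,
    ((partialOmega_self_commute_z hq j).pow_right n).eq]

theorem zs_pow_mul_z (hq : q ≠ 0) (j : Fin N) (n : ℕ) :
    zs q j ^ (n + 1) * z q j = partialOmega q N j * zs q j ^ n -
      (q ^ 2) ^ (n + 1) • (partialOmega q N (j + 1) * zs q j ^ n) := by
  have h := (partialOmega_qcommute_zs hq (Nat.lt_succ_self j.val)).symm
    (pow_ne_zero _ (inv_ne_zero hq))
  have h2 := h.pow_left n
  unfold QCommute at h2
  rw [← inv_pow, inv_inv] at h2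
  rw [pow_succ, mul_assoc, zs_mul_z, mul_sub, mul_smul_comm, h2,
    ((partialOmega_self_commute_zs hq j).pow_right n).eq, smul_smul, ← pow_succ']

theorem z_pow_mem_center {m : ℕ} (hm : m ≠ 0) (hq : q ^ m = 1) (j : Fin N) :
    z q j ^ m ∈ Subalgebra.center ℂ (Fq q N) := by
  have hq0 : q ≠ 0 := by rintro rfl; simp [hm] at hq
  refine mem_center_of_commute (fun i => ?_) fun i => ?_
  · rcases lt_trichotomy i j with h | rfl | h
    · rw [← qcommute_one_iff, ← hq]
      exact (z_qcommute_z' hq0 h).pow_left m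
    · exact (Commute.refl _).pow_left m
    · rw [← qcommute_one_iff, ← inv_one, ← hq, ← inv_pow]
      exact (z_qcommute_z h).pow_left m
  · rcases eq_or_ne j i with rfl | h
    · obtain ⟨n, rfl⟩ := Nat.exists_eq_succ_of_ne_zero hm
      have h1 : (q⁻¹ ^ 2) ^ n = q ^ 2 := by
        have : (q⁻¹ ^ 2) ^ (n + 1) = 1 := by rw [← pow_mul, mul_comm, pow_mul, inv_pow, hq]; simp
        rw [pow_succ] at this
        field_simp at this ⊢
        simpa using this
      unfold Commute SemiconjBy
      rw [Nat.succ_eq_add_one, z_pow_mul_zs hq0, pow_succ' (z q j), ← mul_assoc, zs_mul_z, sub_mul,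
        smul_mul_assoc, h1]
    · rw [← qcommute_one_iff, ← inv_one, ← hq, ← inv_pow]
      exact (z_qcommute_zs h).pow_left m

theorem zs_pow_mem_center {m : ℕ} (hm : m ≠ 0) (hq : q ^ m = 1) (j : Fin N) :
    zs q j ^ m ∈ Subalgebra.center ℂ (Fq q N) := by
  have hq0 : q ≠ 0 := by rintro rfl; simp [hm] at hq
  refine mem_center_of_commute (fun i => ?_) fun i => ?_
  · rcases eq_or_ne j i with rfl | h
    · obtain ⟨n, rfl⟩ := Nat.exists_eq_succ_of_ne_zero hm
      have h1 : (q ^ 2) ^ (n + 1) = 1 := by rw [← pow_mul, mul_comm, pow_mul, hq]; simp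
      unfold Commute SemiconjBy
      rw [Nat.succ_eq_add_one, zs_pow_mul_z hq0, pow_succ' (zs q j), ← mul_assoc, z_mul_zs, sub_mul,
        h1, one_smul]
    · rw [← qcommute_one_iff, ← hq]
      exact (zs_qcommute_z hq0 h).pow_left m
  · rcases lt_trichotomy j i with h | rfl | h
    · rw [← qcommute_one_iff, ← hq]
      exact (zs_qcommute_zs h).pow_left m
    · exact (Commute.refl _).pow_left m
    · rw [← qcommute_one_iff, ← inv_one, ← hq, ← inv_pow]
      exact (zs_qcommute_zs' hq0 h).pow_left m

theorem Omega_mem_center (hq : q ≠ 0) :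
    Omega q N ∈ Subalgebra.center ℂ (Fq q N) := by
  rw [← partialOmega_zero]
  exact mem_center_of_commute (fun i => partialOmega_commute_z hq (Nat.zero_le _))
    fun i => partialOmega_commute_zs hq (Nat.zero_le _)

theorem z_commute_zs_last {j : Fin N} (hj : j.val + 1 = N) : Commute (z q j) (zs q j) := by
  unfold Commute SemiconjBy
  rw [zs_mul_z, z_mul_zs, hj, partialOmega_self]
  simp

theorem z_pow_mul_zs_pow_last_mem_center (hq0 : q ≠ 0) {a b : ℕ} (hq : q ^ (a + b) = 1)
    {j : Fin N} (hj : j.val + 1 = N) :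
    z q j ^ a * zs q j ^ b ∈ Subalgebra.center ℂ (Fq q N) := by
  have hc := z_commute_zs_last (q := q) hj
  refine mem_center_of_commute (fun i => ?_) fun i => ?_
  · rcases eq_or_ne i j with rfl | h
    · exact ((Commute.refl _).pow_left a).mul_left (hc.symm.pow_left b)
    · have hij : i < j := lt_of_le_of_ne (Fin.le_def.2 (by omega)) h
      rw [← qcommute_one_iff, ← hq, pow_add]
      exact ((z_qcommute_z' hq0 hij).pow_left a).mul_left ((zs_qcommute_z hq0 h.symm).pow_left b)
  · rcases eq_or_ne i j with rfl | h
    · exact (hc.pow_left a).mul_left ((Commute.refl _).pow_left b)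
    · have hij : i < j := lt_of_le_of_ne (Fin.le_def.2 (by omega)) h
      rw [← qcommute_one_iff, ← inv_one, ← hq, ← inv_pow, pow_add]
      exact ((z_qcommute_zs h.symm).pow_left a).mul_left ((zs_qcommute_zs' hq0 hij).pow_left b)

end Relations

section Monomials

variable {N : ℕ} {q : ℂ}

/-- The signed power: `z_k ^ n` for `n ≥ 0` and `(z_k^*) ^ (-n)` for `n < 0`. -/
noncomputable def signedPow (q : ℂ) {N : ℕ} (k : Fin N) (n : ℤ) : Fq q N :=
  z q k ^ n.toNat * zs q k ^ (-n).toNat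

theorem signedPow_zero (k : Fin N) : signedPow q k 0 = 1 := by
  simp [signedPow]

theorem z_mul_signedPow_of_nonneg (k : Fin N) {n : ℤ} (hn : 0 ≤ n) :
    z q k * signedPow q k n = signedPow q k (n + 1) := by
  have h1 : (n + 1).toNat = n.toNat + 1 := by omega
  have h2 : (-n).toNat = 0 := by omega
  have h3 : (-(n + 1)).toNat = 0 := by omega
  rw [signedPow, signedPow, h1, h2, h3, pow_succ', mul_assoc]

theorem z_mul_signedPow_of_neg (k : Fin N) {n : ℤ} (hn : n < 0) :
    z q k * signedPow q k n =
      (partialOmega q N k - partialOmega q N (k + 1)) * signedPow q k (n + 1) := by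
  have h1 : (n + 1).toNat = 0 := by omega
  have h2 : (-n).toNat = (-(n + 1)).toNat + 1 := by omega
  have h3 : n.toNat = 0 := by omega
  rw [signedPow, signedPow, h1, h2, h3, pow_succ', ← z_mul_zs]
  simp [mul_assoc]

theorem zs_mul_signedPow_of_nonpos (k : Fin N) {n : ℤ} (hn : n ≤ 0) :
    zs q k * signedPow q k n = signedPow q k (n - 1) := by
  have h1 : (-(n - 1)).toNat = (-n).toNat + 1 := by omega
  have h2 : n.toNat = 0 := by omega
  have h3 : (n - 1).toNat = 0 := by omega
  rw [signedPow, signedPow, h1, h2, h3, pow_succ']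
  simp

theorem zs_mul_signedPow_of_pos (k : Fin N) {n : ℤ} (hn : 0 < n) :
    zs q k * signedPow q k n =
      (partialOmega q N k - q ^ 2 • partialOmega q N (k + 1)) * signedPow q k (n - 1) := by
  have h1 : n.toNat = (n - 1).toNat + 1 := by omega
  have h2 : (-n).toNat = 0 := by omega
  have h3 : (-(n - 1)).toNat = 0 := by omega
  rw [signedPow, signedPow, h1, h2, h3, pow_succ', ← zs_mul_z]
  simp [mul_assoc]

theorem signedPow_qcommute (k : Fin N) (n : ℤ) {w : Fq q N} {c c' : ℂ}
    (h : QCommute c (z q k) w) (h' : QCommute c' (zs q k) w) :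
    QCommute (c ^ n.toNat * c' ^ (-n).toNat) (signedPow q k n) w :=
  (h.pow_left _).mul_left (h'.pow_left _)

/-- Ordered products of signed powers. -/
noncomputable def torusMonomial (q : ℂ) {N : ℕ} (d : Fin N → ℤ) : Fq q N :=
  ((List.finRange N).map fun k => signedPow q k (d k)).prod

/-- Products of powers of the partial sums `∑_{k ≥ i} z_k z_k^*`. -/
noncomputable def omegaMonomial (q : ℂ) {N : ℕ} (a : Fin N → ℕ) : Fq q N :=
  ((List.finRange N).map fun k : Fin N => partialOmega q N k ^ a k).prod

/-- The monomials forming a basis of `F_q(N)`. -/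
noncomputable def basisMonomial (q : ℂ) {N : ℕ} (p : (Fin N →₀ ℕ) × (Fin N → ℤ)) : Fq q N :=
  omegaMonomial q p.1 * torusMonomial q p.2

theorem omegaMonomial_eq (hq : q ≠ 0) (a : Fin N → ℕ) (j : Fin N) :
    omegaMonomial q a = partialOmega q N j ^ a j * omegaMonomial q (Function.update a j 0) := by
  obtain ⟨c, hc, h⟩ := list_prod_eq_smul_mul_update (⊥ : Submonoid ℂ) j
    (fun k : Fin N => partialOmega q N k ^ a k)
    (fun k _ => ⟨1, Submonoid.one_mem _,
      qcommute_one_iff.2 ((partialOmega_commute hq _ _).pow_pow _ _)⟩)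
    (List.finRange N) (List.nodup_finRange N) (List.mem_finRange j)
  rw [Submonoid.mem_bot] at hc
  rw [hc, one_smul] at h
  rw [omegaMonomial, h, omegaMonomial]
  congr 3
  ext k
  rcases eq_or_ne k j with rfl | hk
  · simp
  · simp [Function.update_of_ne hk]

theorem partialOmega_mul_omegaMonomial (hq : q ≠ 0) (a : Fin N → ℕ) (j : Fin N) :
    partialOmega q N j * omegaMonomial q a =
      omegaMonomial q (Function.update a j (a j + 1)) := by
  rw [omegaMonomial_eq hq a j, omegaMonomial_eq hq (Function.update a j (a j + 1)) j,
    Function.update_self, Function.update_idem, pow_succ', mul_assoc]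

theorem signedPow_qcommute_signedPow (hq : q ≠ 0) {k j : Fin N} (h : k ≠ j) (n n' : ℤ) :
    ∃ c : ℂ, c ≠ 0 ∧ QCommute c (signedPow q k n) (signedPow q j n') := by
  have hz : ∃ c : ℂ, c ≠ 0 ∧ QCommute c (z q k) (z q j) := by
    rcases lt_or_gt_of_ne h with h | h
    · exact ⟨_, inv_ne_zero hq, z_qcommute_z h⟩
    · exact ⟨_, hq, z_qcommute_z' hq h⟩
  have hzs : ∃ c : ℂ, c ≠ 0 ∧ QCommute c (zs q k) (zs q j) := by
    rcases lt_or_gt_of_ne h with h | h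
    · exact ⟨_, hq, zs_qcommute_zs h⟩
    · exact ⟨_, inv_ne_zero hq, zs_qcommute_zs' hq h⟩
  obtain ⟨c, hc, hz⟩ := hz
  obtain ⟨c', hc', hzs⟩ := hzs
  exact ⟨_, by positivity, signedPow_qcommute k n
    ((hz.pow_right _).mul_right ((z_qcommute_zs h).pow_right _))
    (((zs_qcommute_z hq h).pow_right _).mul_right (hzs.pow_right _))⟩

theorem torusMonomial_eq (hq : q ≠ 0) (d : Fin N → ℤ) (j : Fin N) :
    ∃ c : ℂ, c ≠ 0 ∧ torusMonomial q d =
      c • (signedPow q j (d j) * torusMonomial q (Function.update d j 0)) := by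
  obtain ⟨c, hc, h⟩ := list_prod_eq_smul_mul_update (nonZeroDivisors ℂ) j
    (fun k => signedPow q k (d k))
    (fun k hk => by
      obtain ⟨c, hc, h⟩ := signedPow_qcommute_signedPow hq hk (d k) (d j)
      exact ⟨c, mem_nonZeroDivisors_of_ne_zero hc, h⟩)
    (List.finRange N) (List.nodup_finRange N) (List.mem_finRange j)
  refine ⟨c, nonZeroDivisors.ne_zero hc, ?_⟩
  rw [torusMonomial, h, torusMonomial]
  congr 4
  ext k
  rcases eq_or_ne k j with rfl | hk
  · simp [signedPow_zero]
  · simp [Function.update_of_ne hk]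

theorem signedPow_mul_torusMonomial (hq : q ≠ 0) (d : Fin N → ℤ) (j : Fin N) (n : ℤ) :
    ∃ c : ℂ, signedPow q j n * torusMonomial q (Function.update d j 0) =
      c • torusMonomial q (Function.update d j n) := by
  obtain ⟨c, hc, h⟩ := torusMonomial_eq hq (Function.update d j n) j
  refine ⟨c⁻¹, ?_⟩
  rw [h, Function.update_self, Function.update_idem, smul_smul, inv_mul_cancel₀ hc, one_smul]

theorem omegaMonomial_qcommute_z (hq : q ≠ 0) (a : Fin N → ℕ) (j : Fin N) :
    QCommute (∏ k : Fin N, if j < k then (q ^ 2) ^ a k else 1) (omegaMonomial q a) (z q j) := by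
  rw [Fin.prod_univ_def]
  refine QCommute.list_prod_left _ (fun k : Fin N => partialOmega q N k ^ a k) _ fun k _ => ?_
  split_ifs with h
  · exact (partialOmega_qcommute_z hq h).pow_left _
  · exact qcommute_one_iff.2 ((partialOmega_commute_z hq (not_lt.1 h)).pow_left _)

theorem omegaMonomial_qcommute_zs (hq : q ≠ 0) (a : Fin N → ℕ) (j : Fin N) :
    QCommute (∏ k : Fin N, if j < k then (q⁻¹ ^ 2) ^ a k else 1) (omegaMonomial q a)
      (zs q j) := by
  rw [Fin.prod_univ_def]
  refine QCommute.list_prod_left _ (fun k : Fin N => partialOmega q N k ^ a k) _ fun k _ => ?_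
  split_ifs with h
  · exact (partialOmega_qcommute_zs hq h).pow_left _
  · exact qcommute_one_iff.2 ((partialOmega_commute_zs hq (not_lt.1 h)).pow_left _)

theorem omegaMonomial_commute_partialOmega (hq : q ≠ 0) (a : Fin N → ℕ) (i : ℕ) :
    Commute (omegaMonomial q a) (partialOmega q N i) := by
  refine Commute.list_prod_left _ _ fun x hx => ?_
  obtain ⟨k, _, rfl⟩ := List.mem_map.1 hx
  exact (partialOmega_commute hq _ _).pow_left _

theorem torusMonomial_qcommute_partialOmega (hq : q ≠ 0) (d : Fin N → ℤ) (i : ℕ) :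
    QCommute (∏ k : Fin N, if k.val < i then (q ^ 2) ^ (-d k) else 1) (torusMonomial q d)
      (partialOmega q N i) := by
  rw [Fin.prod_univ_def]
  refine QCommute.list_prod_left _ _ _ fun k _ => ?_
  split_ifs with h
  · have h1 := signedPow_qcommute k (d k)
      ((partialOmega_qcommute_z hq h).symm (pow_ne_zero _ hq))
      ((partialOmega_qcommute_zs hq h).symm (pow_ne_zero _ (inv_ne_zero hq)))
    convert h1 using 1
    rw [inv_pow q, inv_inv]
    rcases le_total 0 (d k) with h0 | h0
    · obtain ⟨n, hn⟩ := Int.eq_ofNat_of_zero_le h0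
      simp [hn]
    · obtain ⟨n, hn⟩ := Int.eq_ofNat_of_zero_le (neg_nonneg.2 h0)
      have : (d k).toNat = 0 := by omega
      rw [hn, this]
      simp
  · have h1 := signedPow_qcommute k (d k)
      (qcommute_one_iff.2 (partialOmega_commute_z hq (not_lt.1 h)).symm)
      (qcommute_one_iff.2 (partialOmega_commute_zs hq (not_lt.1 h)).symm)
    simpa using h1

theorem span_basisMonomial (hq : q ≠ 0) :
    Submodule.span ℂ (Set.range (basisMonomial q (N := N))) = ⊤ := by
  set S := Submodule.span ℂ (Set.range (basisMonomial q (N := N))) with hS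
  have hmem : ∀ (a : Fin N → ℕ) d, omegaMonomial q a * torusMonomial q d ∈ S := fun a d =>
    Submodule.subset_span ⟨(Finsupp.equivFunOnFinite.symm a, d), rfl⟩
  have hOm : ∀ (a : Fin N → ℕ) d (i : ℕ), i ≤ N →
      omegaMonomial q a * (partialOmega q N i * torusMonomial q d) ∈ S := by
    intro a d i hi
    rcases hi.lt_or_eq with hi | rfl
    · rw [← mul_assoc, (omegaMonomial_commute_partialOmega hq a i).eq,
        partialOmega_mul_omegaMonomial hq a ⟨i, hi⟩]
      exact hmem _ _
    · simp [partialOmega_self]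
  have hzp : ∀ (a : Fin N → ℕ) d (j : Fin N) n,
      omegaMonomial q a * (signedPow q j n * torusMonomial q (Function.update d j 0)) ∈ S := by
    intro a d j n
    obtain ⟨c, h⟩ := signedPow_mul_torusMonomial hq d j n
    rw [h, mul_smul_comm]
    exact S.smul_mem _ (hmem _ _)
  have hOmzp : ∀ (a : Fin N → ℕ) d (j : Fin N) n (i : ℕ), i ≤ N → omegaMonomial q a *
      (partialOmega q N i * (signedPow q j n * torusMonomial q (Function.update d j 0))) ∈ S := by
    intro a d j n i hi
    obtain ⟨c, h⟩ := signedPow_mul_torusMonomial hq d j n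
    rw [h, mul_smul_comm, mul_smul_comm]
    exact S.smul_mem _ (hOm _ _ _ hi)
  have hz : ∀ (a : Fin N → ℕ) d j, z q j * (omegaMonomial q a * torusMonomial q d) ∈ S := by
    intro a d j
    have h := (omegaMonomial_qcommute_z hq a j).symm
      (Finset.prod_ne_zero_iff.2 fun k _ => by split_ifs <;> simp [hq])
    unfold QCommute at h
    obtain ⟨c, -, hd⟩ := torusMonomial_eq hq d j
    rw [← mul_assoc, h, smul_mul_assoc, hd, mul_smul_comm, mul_assoc, ← mul_assoc (z q j)]
    refine S.smul_mem _ (S.smul_mem _ ?_)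
    rcases le_or_gt 0 (d j) with h0 | h0
    · rw [z_mul_signedPow_of_nonneg j h0]
      exact hzp _ _ _ _
    · rw [z_mul_signedPow_of_neg j h0, sub_mul, sub_mul, mul_sub, mul_assoc, mul_assoc]
      exact S.sub_mem (hOmzp _ _ _ _ _ j.2.le) (hOmzp _ _ _ _ _ j.2)
  have hzs : ∀ (a : Fin N → ℕ) d j, zs q j * (omegaMonomial q a * torusMonomial q d) ∈ S := by
    intro a d j
    have h := (omegaMonomial_qcommute_zs hq a j).symm
      (Finset.prod_ne_zero_iff.2 fun k _ => by split_ifs <;> simp [hq])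
    unfold QCommute at h
    obtain ⟨c, -, hd⟩ := torusMonomial_eq hq d j
    rw [← mul_assoc, h, smul_mul_assoc, hd, mul_smul_comm, mul_assoc, ← mul_assoc (zs q j)]
    refine S.smul_mem _ (S.smul_mem _ ?_)
    rcases le_or_gt (d j) 0 with h0 | h0
    · rw [zs_mul_signedPow_of_nonpos j h0]
      exact hzp _ _ _ _
    · rw [zs_mul_signedPow_of_pos j h0, sub_mul, sub_mul, mul_sub, smul_mul_assoc, smul_mul_assoc,
        mul_smul_comm, mul_assoc, mul_assoc]
      exact S.sub_mem (hOmzp _ _ _ _ _ j.2.le) (S.smul_mem _ (hOmzp _ _ _ _ _ j.2))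
  have hstable : ∀ x : Fq q N, ∀ s ∈ S, x * s ∈ S := by
    intro x
    have hx : x ∈ Algebra.adjoin ℂ (Set.range (z q (N := N)) ∪ Set.range (zs q (N := N))) := by
      rw [adjoin_generators]; trivial
    induction hx using Algebra.adjoin_induction with
    | mem x hx =>
      intro s hs
      induction hs using Submodule.span_induction with
      | mem s hs =>
        obtain ⟨p, rfl⟩ := hs
        rcases hx with ⟨i, rfl⟩ | ⟨i, rfl⟩
        · exact hz _ _ _
        · exact hzs _ _ _
      | zero => simp
      | add a b _ _ ha hb => rw [mul_add]; exact S.add_mem ha hb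
      | smul c a _ ha => rw [mul_smul_comm]; exact S.smul_mem _ ha
    | algebraMap r => intro s hs; rw [← Algebra.smul_def]; exact S.smul_mem _ hs
    | add a b _ _ ha hb => intro s hs; rw [add_mul]; exact S.add_mem (ha s hs) (hb s hs)
    | mul a b _ _ ha hb => intro s hs; rw [mul_assoc]; exact ha _ (hb s hs)
  have h1 : (1 : Fq q N) ∈ S := by
    have := hmem 0 0
    simpa [omegaMonomial, torusMonomial, signedPow_zero] using this
  exact eq_top_iff.2 fun x _ => by simpa using hstable x 1 h1

end Monomials

section Representation

open MvPolynomial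

variable {N : ℕ} {q : ℂ}

/-- Polynomials in the eigenvalues of the partial sums `∑_{k ≥ i} z_k z_k^*`. -/
abbrev Scalars (N : ℕ) : Type := MvPolynomial (Fin N) ℂ

/-- The representation space: functions on `ℤ^N` with polynomial values. -/
abbrev RepSpace (N : ℕ) : Type := (Fin N → ℤ) → Scalars N

/-- The variable `ω_i`, with `ω_i = 0` for `i ≥ N`. -/
noncomputable def weight (N i : ℕ) : Scalars N := if h : i < N then X ⟨i, h⟩ else 0

/-- `∑_{k < i} d_k`. -/
def partialSum (i : ℕ) (d : Fin N → ℤ) : ℤ := ∑ k : Fin N with k.val < i, d k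

theorem partialSum_add (i : ℕ) (d e : Fin N → ℤ) :
    partialSum i (d + e) = partialSum i d + partialSum i e := by
  simp [partialSum, Finset.sum_add_distrib]

theorem partialSum_sub (i : ℕ) (d e : Fin N → ℤ) :
    partialSum i (d - e) = partialSum i d - partialSum i e := by
  simp [partialSum, Finset.sum_sub_distrib]

theorem partialSum_single (i : ℕ) (j : Fin N) :
    partialSum i (Pi.single j 1) = if j.val < i then 1 else 0 := by
  simp [partialSum, Pi.single_apply]

theorem partialSum_succ (j : Fin N) (d : Fin N → ℤ) :
    partialSum (j.val + 1) d = partialSum j.val d + d j := by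
  rw [partialSum, sum_filter_lt_succ, add_comm, partialSum]

/-- The action of `z_j`. -/
noncomputable def repZ (q : ℂ) (j : Fin N) : Module.End ℂ (RepSpace N) where
  toFun f d := C (q ^ partialSum j d) * f (d - Pi.single j 1)
  map_add' f g := by ext1 d; simp [mul_add]
  map_smul' c f := by ext1 d; simp

/-- The action of `z_j^*`. -/
noncomputable def repZs (q : ℂ) (j : Fin N) : Module.End ℂ (RepSpace N) where
  toFun f d := (C (q ^ partialSum j d) * weight N j -
    C (q ^ (partialSum j d + 2 * d j + 2)) * weight N (j + 1)) * f (d + Pi.single j 1)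
  map_add' f g := by ext1 d; simp [mul_add]
  map_smul' c f := by ext1 d; simp

theorem repZ_apply (j : Fin N) (f : RepSpace N) (d : Fin N → ℤ) :
    repZ q j f d = C (q ^ partialSum j d) * f (d - Pi.single j 1) := rfl

theorem repZs_apply (j : Fin N) (f : RepSpace N) (d : Fin N → ℤ) :
    repZs q j f d = (C (q ^ partialSum j d) * weight N j -
    C (q ^ (partialSum j d + 2 * d j + 2)) * weight N (j + 1)) * f (d + Pi.single j 1) := rfl

/-- The eigenvalue of `∑_{k ≥ i} z_k z_k^*` at `d`. -/
noncomputable def omegaEigenvalue (q : ℂ) (i : ℕ) (d : Fin N → ℤ) : Scalars N :=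
  C (q ^ (2 * partialSum i d)) * weight N i

theorem omegaEigenvalue_self (d : Fin N → ℤ) : omegaEigenvalue q N d = 0 := by
  simp [omegaEigenvalue, weight]

theorem repZ_mul_repZs (hq : q ≠ 0) (j : Fin N) (f : RepSpace N) (d : Fin N → ℤ) :
    (repZ q j * repZs q j) f d =
      (omegaEigenvalue q j d - omegaEigenvalue q (j + 1) d) * f d := by
  rw [Module.End.mul_apply, repZ_apply, repZs_apply, partialSum_sub, partialSum_single,
    omegaEigenvalue, omegaEigenvalue, partialSum_succ, sub_add_cancel]
  simp only [lt_irrefl, if_false, sub_zero, Pi.sub_apply, Pi.single_eq_same]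
  have h1 : q ^ (2 * partialSum j d) = q ^ partialSum j d * q ^ partialSum j d := by
    rw [← zpow_add₀ hq]; congr 1; ring
  have h2 : q ^ (2 * (partialSum j d + d j)) =
      q ^ partialSum j d * q ^ (partialSum j d + 2 * (d j - 1) + 2) := by
    rw [← zpow_add₀ hq]; congr 1; ring
  rw [h1, h2, C_mul, C_mul]
  ring

theorem repZs_mul_repZ (hq : q ≠ 0) (j : Fin N) (f : RepSpace N) (d : Fin N → ℤ) :
    (repZs q j * repZ q j) f d =
      (omegaEigenvalue q j d - C (q ^ 2) * omegaEigenvalue q (j + 1) d) * f d := by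
  rw [Module.End.mul_apply, repZs_apply, repZ_apply, partialSum_add, partialSum_single,
    omegaEigenvalue, omegaEigenvalue, partialSum_succ, add_sub_cancel_right]
  simp only [lt_irrefl, if_false, add_zero]
  have h1 : q ^ (2 * partialSum j d) = q ^ partialSum j d * q ^ partialSum j d := by
    rw [← zpow_add₀ hq]; congr 1; ring
  have h2 : q ^ (2 : ℕ) * q ^ (2 * (partialSum j d + d j)) =
      q ^ partialSum j d * q ^ (partialSum j d + 2 * d j + 2) := by
    rw [← zpow_natCast, ← zpow_add₀ hq, ← zpow_add₀ hq]; congr 1; push_cast; ring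
  rw [← mul_assoc (C (q ^ 2)), ← C_mul, h1, h2, C_mul, C_mul]
  ring

theorem sum_repZ_mul_repZs (hq : q ≠ 0) {i : ℕ} (hi : i ≤ N) (f : RepSpace N) (d : Fin N → ℤ) :
    (∑ k : Fin N with i ≤ k.val, repZ q k * repZs q k) f d = omegaEigenvalue q i d * f d := by
  rw [LinearMap.sum_apply, Finset.sum_apply]
  simp only [repZ_mul_repZs hq]
  rw [← Finset.sum_mul, sum_filter_le_sub (fun i => omegaEigenvalue q i d)
    (omegaEigenvalue_self d) i hi]

theorem repZ_qcommute_repZ (hq : q ≠ 0) {i j : Fin N} (h : i < j) :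
    repZ q i * repZ q j = q⁻¹ • (repZ q j * repZ q i) := by
  refine LinearMap.ext fun f => funext fun d => ?_
  have h' : ¬ j.val < i.val := not_lt.2 h.le
  simp only [Module.End.mul_apply, LinearMap.smul_apply, Pi.smul_apply, repZ_apply, partialSum_sub,
    partialSum_single, Fin.val_fin_lt.2 h, h', if_true, if_false, sub_zero, smul_eq_C_mul]
  rw [zpow_sub_one₀ hq, C_mul, sub_right_comm]
  ring

theorem repZs_qcommute_repZs (hq : q ≠ 0) {i j : Fin N} (h : i < j) :
    repZs q i * repZs q j = q • (repZs q j * repZs q i) := by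
  refine LinearMap.ext fun f => funext fun d => ?_
  have h' : ¬ j.val < i.val := not_lt.2 h.le
  simp only [Module.End.mul_apply, LinearMap.smul_apply, Pi.smul_apply, repZs_apply, Pi.add_apply,
    partialSum_add, Pi.single_eq_of_ne h.ne, Pi.single_eq_of_ne h.ne',
    partialSum_single, Fin.val_fin_lt.2 h, h', if_true, if_false, add_zero, smul_eq_C_mul]
  simp only [zpow_add₀ hq, zpow_one, C_mul, add_right_comm d]
  ring

theorem repZ_qcommute_repZs (hq : q ≠ 0) {i j : Fin N} (h : i ≠ j) :
    repZ q i * repZs q j = q⁻¹ • (repZs q j * repZ q i) := by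
  refine LinearMap.ext fun f => funext fun d => ?_
  have h2 : d - Pi.single i 1 + Pi.single j 1 = d + Pi.single j 1 - Pi.single i 1 :=
    sub_add_eq_add_sub _ _ _
  rcases lt_or_gt_of_ne h with h | h
  all_goals
    have h' := not_lt.2 (Fin.le_def.1 h.le)
    simp only [Module.End.mul_apply, LinearMap.smul_apply, Pi.smul_apply, repZs_apply, repZ_apply,
      Pi.sub_apply, partialSum_add, partialSum_sub, Pi.single_eq_of_ne h.ne,
      Pi.single_eq_of_ne h.ne', partialSum_single, Fin.val_fin_lt.2 h, h', if_true, if_false,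
      add_zero, sub_zero, smul_eq_C_mul, h2]
    simp only [zpow_add₀ hq, zpow_sub_one₀ hq, zpow_one, C_mul]
  · ring
  · have : (C q⁻¹ : Scalars N) * C q = 1 := by rw [← C_mul, inv_mul_cancel₀ hq, C_1]
    linear_combination (-(C (q ^ partialSum i d) * (C (q ^ partialSum j d) * weight N j -
      C (q ^ partialSum j d) * C (q ^ (2 * d j)) * C (q ^ (2 : ℤ)) * weight N (j + 1)) *
        f (d + Pi.single j 1 - Pi.single i 1))) * this

/-- The faithful representation of `F_q(N)` on functions on `ℤ^N`. -/
noncomputable def rep (hq : q ≠ 0) : Fq q N →ₐ[ℂ] Module.End ℂ (RepSpace N) :=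
  RingQuot.liftAlgHom ℂ ⟨FreeAlgebra.lift ℂ fun g : Gen N => match g with
    | .z i => repZ q i
    | .zs i => repZs q i, by
    intro x y h
    cases h with
    | z_z i j h => simpa using repZ_qcommute_repZ hq h
    | zs_zs i j h => simpa using repZs_qcommute_repZs hq h
    | z_zs i j h => simpa using repZ_qcommute_repZs hq h
    | z_zs_self i =>
      simp only [map_sub, map_mul, map_smul, map_sum, FreeAlgebra.lift_ι_apply]
      have h2 : ∑ k ∈ Finset.Ioi i, repZ q k * repZs q k =
          ∑ k : Fin N with i.val + 1 ≤ k.val, repZ q k * repZs q k := by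
        refine Finset.sum_congr ?_ fun _ _ => rfl
        ext k
        rw [Finset.mem_Ioi, Finset.mem_filter, Fin.lt_def, Nat.succ_le_iff]
        simp
      rw [h2]
      refine LinearMap.ext fun f => funext fun d => ?_
      rw [LinearMap.sub_apply, Pi.sub_apply, LinearMap.smul_apply, Pi.smul_apply,
        repZ_mul_repZs hq, repZs_mul_repZ hq, sum_repZ_mul_repZs hq i.2, smul_eq_C_mul, C_sub, C_1]
      ring⟩

theorem rep_z (hq : q ≠ 0) (j : Fin N) : rep hq (z q j) = repZ q j := by
  simp [rep, z]

theorem rep_zs (hq : q ≠ 0) (j : Fin N) : rep hq (zs q j) = repZs q j := by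
  simp [rep, zs]

theorem rep_partialOmega (hq : q ≠ 0) {i : ℕ} (hi : i ≤ N) (f : RepSpace N) (d : Fin N → ℤ) :
    rep hq (partialOmega q N i) f d = omegaEigenvalue q i d * f d := by
  simp only [partialOmega, map_sum, map_mul, rep_z, rep_zs]
  exact sum_repZ_mul_repZs hq hi f d

theorem rep_partialOmega_pow_mul (hq : q ≠ 0) {i : ℕ} (hi : i ≤ N) (n : ℕ) (x : Fq q N)
    (f : RepSpace N) (d : Fin N → ℤ) :
    rep hq (partialOmega q N i ^ n * x) f d = omegaEigenvalue q i d ^ n * rep hq x f d := by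
  induction n with
  | zero => simp
  | succ n ih =>
    rw [pow_succ', mul_assoc, map_mul, Module.End.mul_apply, rep_partialOmega hq hi, ih, pow_succ',
      mul_assoc]

theorem rep_partialOmega_pow (hq : q ≠ 0) {i : ℕ} (hi : i ≤ N) (n : ℕ) (f : RepSpace N)
    (d : Fin N → ℤ) :
    rep hq (partialOmega q N i ^ n) f d = omegaEigenvalue q i d ^ n * f d := by
  simpa using rep_partialOmega_pow_mul hq hi n 1 f d

/-- `T` sends every nonzero function supported at a point `d` to one supported at `d + e`. -/
def Shifts (T : Module.End ℂ (RepSpace N)) (e : Fin N → ℤ) : Prop :=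
  ∀ d g, g ≠ 0 → ∃ g', g' ≠ 0 ∧ T (Pi.single d g) = Pi.single (d + e) g'

theorem Shifts.one : Shifts (1 : Module.End ℂ (RepSpace N)) 0 :=
  fun _ g hg => ⟨g, hg, by simp⟩

theorem Shifts.mul {T T' : Module.End ℂ (RepSpace N)} {e e' : Fin N → ℤ} (h : Shifts T e)
    (h' : Shifts T' e') : Shifts (T * T') (e + e') := by
  intro d g hg
  obtain ⟨g', hg', h1⟩ := h' d g hg
  obtain ⟨g'', hg'', h2⟩ := h _ g' hg'
  exact ⟨g'', hg'', by rw [Module.End.mul_apply, h1, h2, add_assoc, add_comm e']⟩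

theorem Shifts.pow {T : Module.End ℂ (RepSpace N)} {e : Fin N → ℤ} (h : Shifts T e) (n : ℕ) :
    Shifts (T ^ n) (n • e) := by
  induction n with
  | zero => simpa using Shifts.one
  | succ n ih => rw [pow_succ, succ_nsmul]; exact ih.mul h

theorem Shifts.list_prod {ι : Type*} (l : List ι) (T : ι → Module.End ℂ (RepSpace N))
    (e : ι → Fin N → ℤ) (h : ∀ i ∈ l, Shifts (T i) (e i)) :
    Shifts (l.map T).prod (l.map e).sum := by
  induction l with
  | nil => simpa using Shifts.one
  | cons i l ih =>
    simp only [List.map_cons, List.prod_cons, List.sum_cons]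
    exact (h i (by simp)).mul (ih fun k hk => h k (by simp [hk]))

theorem shifts_repZ (hq : q ≠ 0) (j : Fin N) : Shifts (repZ q j) (Pi.single j 1) := by
  intro d g hg
  refine ⟨C (q ^ partialSum j (d + Pi.single j 1)) * g,
    mul_ne_zero (by simpa using zpow_ne_zero _ hq) hg, funext fun d' => ?_⟩
  rw [repZ_apply]
  rcases eq_or_ne d' (d + Pi.single j 1) with rfl | h
  · simp
  · rw [Pi.single_eq_of_ne h, Pi.single_eq_of_ne (by rwa [Ne, sub_eq_iff_eq_add]), mul_zero]

theorem weight_sub_ne_zero {a b : ℂ} (ha : a ≠ 0) (j : Fin N) :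
    C a * weight N j - C b * weight N (j + 1) ≠ 0 := by
  intro h
  have := congrArg (MvPolynomial.coeff (Finsupp.single j 1)) h
  simp only [weight, coeff_sub, coeff_C_mul, coeff_zero] at this
  rw [dif_pos j.2] at this
  split_ifs at this with h1
  · rw [coeff_X, coeff_X, if_pos rfl, if_neg] at this
    · simp [ha] at this
    · intro h2
      have := Finsupp.single_left_injective one_ne_zero h2
      simp [Fin.ext_iff] at this
  · rw [coeff_X, if_pos rfl] at this
    simp [ha] at this

theorem shifts_repZs (hq : q ≠ 0) (j : Fin N) : Shifts (repZs q j) (-Pi.single j 1) := by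
  intro d g hg
  refine ⟨_, mul_ne_zero (weight_sub_ne_zero
    (b := q ^ (partialSum j (d - Pi.single j 1) + 2 * (d j - 1) + 2))
    (zpow_ne_zero (partialSum j (d - Pi.single j 1)) hq) j) hg, funext fun d' => ?_⟩
  rw [repZs_apply, ← sub_eq_add_neg]
  rcases eq_or_ne d' (d - Pi.single j 1) with rfl | h
  · simp
  · rw [Pi.single_eq_of_ne h, Pi.single_eq_of_ne (by rwa [Ne, ← eq_sub_iff_add_eq]), mul_zero]

theorem shifts_torusMonomial (hq : q ≠ 0) (d : Fin N → ℤ) :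
    Shifts (rep hq (torusMonomial q d)) d := by
  have h := Shifts.list_prod (List.finRange N) (fun k => rep hq (signedPow q k (d k)))
    (fun k => Pi.single k (d k)) fun k _ => by
      have h := ((shifts_repZ hq k).pow (d k).toNat).mul ((shifts_repZs hq k).pow (-d k).toNat)
      simp only [signedPow, map_mul, map_pow, rep_z, rep_zs]
      convert h using 1
      rw [smul_neg, ← natCast_zsmul, ← natCast_zsmul, ← neg_smul, ← add_smul, ← Pi.single_smul]
      congr 1
      simp only [smul_eq_mul, mul_one]
      omega
  rw [torusMonomial, map_list_prod, List.map_map]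
  rw [← Fin.sum_univ_def, Finset.univ_sum_single] at h
  exact h

theorem rep_omegaMonomial (hq : q ≠ 0) (a : Fin N →₀ ℕ) (d : Fin N → ℤ) :
    ∃ u : ℂ, u ≠ 0 ∧ ∀ f, rep hq (omegaMonomial q a) f d = monomial a u * f d := by
  have h : ∀ (l : List (Fin N)) f, rep hq (l.map fun k : Fin N => partialOmega q N k ^ a k).prod f d =
      (l.map fun k : Fin N => omegaEigenvalue q k d ^ a k).prod * f d := by
    intro l
    induction l with
    | nil => simp
    | cons k l ih =>
      intro f
      rw [List.map_cons, List.prod_cons, rep_partialOmega_pow_mul hq k.2.le, ih, List.map_cons,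
        List.prod_cons, mul_assoc]
  refine ⟨∏ k : Fin N, (q ^ (2 * partialSum k d)) ^ a k,
    Finset.prod_ne_zero_iff.2 fun k _ => pow_ne_zero _ (zpow_ne_zero _ hq), fun f => ?_⟩
  rw [omegaMonomial, h, ← Fin.prod_univ_def, monomial_eq, Finsupp.prod_fintype _ _ (by simp),
    map_prod, ← Finset.prod_mul_distrib]
  congr 2
  ext1 k
  simp [omegaEigenvalue, weight, mul_pow]

theorem linearIndependent_rep_basisMonomial (hq : q ≠ 0) :
    LinearIndependent ℂ fun p => rep hq (basisMonomial q (N := N) p) (Pi.single 0 1) := by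
  have h1 : ∀ d : Fin N → ℤ, ∃ g : Scalars N, g ≠ 0 ∧
      rep hq (torusMonomial q d) (Pi.single 0 1) = Pi.single d g := fun d => by
    simpa using shifts_torusMonomial hq d 0 1 one_ne_zero
  choose g hg hgd using h1
  choose u hu hud using rep_omegaMonomial (N := N) hq
  have hv : ∀ p, rep hq (basisMonomial q (N := N) p) (Pi.single 0 1) =
      Pi.single p.2 (monomial p.1 (u p.1 p.2) * g p.2) := by
    intro p
    ext1 d
    rw [basisMonomial, map_mul, Module.End.mul_apply, hgd, hud]
    rcases eq_or_ne d p.2 with rfl | h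
    · simp
    · simp [Pi.single_eq_of_ne h]
  simp only [hv]
  rw [linearIndependent_iff']
  rintro s c hs ⟨a, d⟩ hp
  have h2 := congrFun hs d
  rw [Finset.sum_apply] at h2
  have h3 : (∑ p ∈ s, if p.2 = d then monomial p.1 (c p * u p.1 d) else 0) * g d = 0 := by
    rw [Finset.sum_mul]
    refine Eq.trans ?_ h2
    refine Finset.sum_congr rfl fun p _ => ?_
    split_ifs with h
    · rw [← h, Pi.smul_apply, Pi.single_eq_same, ← smul_mul_assoc, smul_monomial, smul_eq_mul]
    · rw [Pi.smul_apply, Pi.single_eq_of_ne (Ne.symm h), smul_zero, zero_mul]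
  have h4 := congrArg (MvPolynomial.coeff a) ((mul_eq_zero.1 h3).resolve_right (hg d))
  rw [coeff_sum, coeff_zero, Finset.sum_eq_single (a, d)] at h4
  · simpa [hu] using h4
  · rintro ⟨a', d'⟩ _ hne
    split_ifs with h
    · rw [coeff_monomial, if_neg]
      rintro rfl
      exact hne (by simp only at h; rw [h])
    · simp
  · exact fun h => absurd hp h

theorem rep_injective (hq : q ≠ 0) : Function.Injective (rep (N := N) hq) := by
  rw [injective_iff_map_eq_zero]
  intro x hx
  have hmem : x ∈ Submodule.span ℂ (Set.range (basisMonomial q (N := N))) := by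
    rw [span_basisMonomial hq]; trivial
  obtain ⟨c, rfl⟩ := Finsupp.mem_span_range_iff_exists_finsupp.1 hmem
  have h := linearIndependent_iff.1 (linearIndependent_rep_basisMonomial (N := N) hq) c (by
    have := LinearMap.congr_fun hx (Pi.single 0 1)
    simpa [Finsupp.linearCombination_apply, Finsupp.sum, map_sum, LinearMap.sum_apply] using this)
  simp [h]

theorem eq_zero_of_z_mul_eq_zero (hq : q ≠ 0) (j : Fin N) {x : Fq q N} (h : z q j * x = 0) :
    x = 0 := by
  refine rep_injective hq ?_
  rw [map_zero]
  refine LinearMap.ext fun f => funext fun d => ?_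
  have h1 := congrFun (LinearMap.congr_fun (congrArg (rep hq) h) f) (d + Pi.single j 1)
  rw [map_mul, Module.End.mul_apply, rep_z, repZ_apply, add_sub_cancel_right, map_zero] at h1
  exact (mul_eq_zero.1 h1).resolve_left (by simpa using zpow_ne_zero _ hq)

theorem eq_zero_of_partialOmega_mul_eq_zero (hq : q ≠ 0) {i : ℕ} (hi : i < N) {x : Fq q N}
    (h : partialOmega q N i * x = 0) : x = 0 := by
  refine rep_injective hq ?_
  rw [map_zero]
  refine LinearMap.ext fun f => funext fun d => ?_
  have h1 := congrFun (LinearMap.congr_fun (congrArg (rep hq) h) f) d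
  rw [map_mul, Module.End.mul_apply, rep_partialOmega hq hi.le, map_zero] at h1
  refine (mul_eq_zero.1 h1).resolve_left ?_
  rw [omegaEigenvalue, weight, dif_pos hi]
  exact mul_ne_zero (by simpa using zpow_ne_zero _ hq) (X_ne_zero _)

/-- `z_j^m (z_j^*)^m = Ω_j^m - Ω_{j+1}^m` for the partial sums `Ω_i = ∑_{k ≥ i} z_k z_k^*`. -/
theorem z_pow_mul_zs_pow {m : ℕ} (hm : Odd m) (hq : IsPrimitiveRoot q m) (j : Fin N) :
    z q j ^ m * zs q j ^ m = partialOmega q N j ^ m - partialOmega q N (j + 1) ^ m := by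
  have hm0 : 0 < m := hm.pos
  have : NeZero m := ⟨hm0.ne'⟩
  have hq0 : q ≠ 0 := hq.ne_zero hm0.ne'
  refine rep_injective hq0 (LinearMap.ext fun f => funext fun d => ?_)
  have hprod : ∀ (n : ℕ) f, rep hq0 (z q j ^ n * zs q j ^ n) f d =
      (∏ l ∈ Finset.range n, (omegaEigenvalue q j d -
        C ((q⁻¹ ^ 2) ^ l) * omegaEigenvalue q (j + 1) d)) * f d := by
    intro n
    induction n with
    | zero => simp
    | succ n ih =>
      intro f
      rw [pow_succ' (zs q j), ← mul_assoc, z_pow_mul_zs hq0, sub_mul, smul_mul_assoc, mul_assoc,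
        mul_assoc, map_sub, map_smul, LinearMap.sub_apply, LinearMap.smul_apply, Pi.sub_apply,
        Pi.smul_apply]
      have h1 := rep_partialOmega_pow_mul hq0 j.2.le 1 (z q j ^ n * zs q j ^ n) f d
      have h2 := rep_partialOmega_pow_mul hq0 (Nat.succ_le_of_lt j.2) 1
        (z q j ^ n * zs q j ^ n) f d
      rw [pow_one, pow_one, ih] at h1 h2
      rw [h1, h2, Finset.prod_range_succ, smul_eq_C_mul]
      ring
  have hroot : IsPrimitiveRoot (C (q⁻¹ ^ 2) : Scalars N) m :=
    (hq.inv.pow_of_coprime 2 hm.coprime_two_left).map_of_injective (C_injective (Fin N) ℂ)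
  rw [hprod, map_sub, LinearMap.sub_apply, Pi.sub_apply, rep_partialOmega_pow hq0 j.2.le,
    rep_partialOmega_pow hq0 j.2, ← sub_mul,
    hroot.pow_sub_pow_eq_prod_sub_mul _ _ hm0]
  congr 1
  refine Finset.prod_bij (fun l _ => C (q⁻¹ ^ 2) ^ l) (fun l _ => ?_) (fun l hl l' hl' h => ?_)
    (fun b hb => ?_) fun l _ => by rw [map_pow C _ l]
  · rw [Polynomial.mem_nthRootsFinset hm0, ← pow_mul, mul_comm, pow_mul, hroot.pow_eq_one, one_pow]
  · exact hroot.pow_inj (Finset.mem_range.1 hl) (Finset.mem_range.1 hl') h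
  · obtain ⟨l, hl, h⟩ :=
      hroot.eq_pow_of_pow_eq_one ((Polynomial.mem_nthRootsFinset hm0 1).1 hb)
    exact ⟨l, Finset.mem_range.2 hl, h⟩

end Representation

section Averaging

variable {A ι : Type*} [Ring A] [Algebra ℂ A]

/-- An element of the span of eigenvectors for conjugation by `w` which commutes with `w` lies in
the span of the eigenvectors with eigenvalue one. -/
theorem mem_span_eigenvalue_one {v : ι → A} {χ : ι → ℂ} {S : Set ι} {w : A} {m : ℕ} (hm : m ≠ 0)
    (hw : ∀ x, w * x = 0 → x = 0) (hv : ∀ p ∈ S, QCommute (χ p) (v p) w)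
    (hχ : ∀ p ∈ S, χ p ^ m = 1) {x : A} (hx : x ∈ Submodule.span ℂ (v '' S)) (hc : Commute x w) :
    x ∈ Submodule.span ℂ (v '' {p ∈ S | χ p = 1}) := by
  have key : ∀ y ∈ Submodule.span ℂ (v '' S),
      ∃ y' ∈ Submodule.span ℂ (v '' {p ∈ S | χ p = 1}),
        ∑ k ∈ Finset.range m, w ^ (m - k) * (y * w ^ k) = (m : ℂ) • (w ^ m * y') := by
    intro y hy
    induction hy using Submodule.span_induction with
    | mem y hy =>
      obtain ⟨p, hp, rfl⟩ := hy
      have h1 : ∑ k ∈ Finset.range m, w ^ (m - k) * (v p * w ^ k) =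
          (∑ k ∈ Finset.range m, χ p ^ k) • (w ^ m * v p) := by
        rw [Finset.sum_smul]
        refine Finset.sum_congr rfl fun k hk => ?_
        have h2 : v p * w ^ k = χ p ^ k • (w ^ k * v p) := (hv p hp).pow_right k
        rw [h2, mul_smul_comm, ← mul_assoc, ← pow_add,
          Nat.sub_add_cancel (Finset.mem_range.1 hk).le]
      rw [h1]
      by_cases h : χ p = 1
      · exact ⟨v p, Submodule.subset_span ⟨p, ⟨hp, h⟩, rfl⟩, by simp [h]⟩
      · exact ⟨0, Submodule.zero_mem _, by simp [geom_sum_eq h, hχ p hp]⟩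
    | zero => exact ⟨0, Submodule.zero_mem _, by simp⟩
    | add a b _ _ ha hb =>
      obtain ⟨a', ha', ha⟩ := ha
      obtain ⟨b', hb', hb⟩ := hb
      exact ⟨a' + b', Submodule.add_mem _ ha' hb', by
        simp only [add_mul, mul_add, Finset.sum_add_distrib, ha, hb, smul_add]⟩
    | smul c a _ ha =>
      obtain ⟨a', ha', ha⟩ := ha
      exact ⟨c • a', Submodule.smul_mem _ _ ha', by
        simp only [smul_mul_assoc, mul_smul_comm, ← Finset.smul_sum, ha]; rw [smul_comm]⟩
  obtain ⟨y, hy, h⟩ := key x hx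
  have h1 : ∑ k ∈ Finset.range m, w ^ (m - k) * (x * w ^ k) = (m : ℂ) • (w ^ m * x) := by
    rw [Finset.sum_congr rfl fun k hk => by
      rw [(hc.pow_right k).eq, ← mul_assoc, ← pow_add,
        Nat.sub_add_cancel (Finset.mem_range.1 hk).le]]
    rw [Finset.sum_const, Finset.card_range, Nat.cast_smul_eq_nsmul]
  rw [h1] at h
  have h2 : w ^ m * (x - y) = 0 := by
    rw [mul_sub, sub_eq_zero]
    exact smul_right_injective A (Nat.cast_ne_zero.2 hm : (m : ℂ) ≠ 0) h
  have h3 : ∀ n (t : A), w ^ n * t = 0 → t = 0 := by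
    intro n
    induction n with
    | zero => simp
    | succ n ih => exact fun t ht => ih t (hw _ (by rwa [← mul_assoc, ← pow_succ']))
  rwa [sub_eq_zero.1 (h3 m _ h2)]

theorem mem_span_forall_eigenvalue_one {κ : Type*} {v : ι → A} {χ : κ → ι → ℂ} {S : Set ι}
    {w : κ → A} {m : ℕ} (hm : m ≠ 0) (T : Finset κ) (hw : ∀ t ∈ T, ∀ x, w t * x = 0 → x = 0)
    (hv : ∀ t ∈ T, ∀ p ∈ S, QCommute (χ t p) (v p) (w t))
    (hχ : ∀ t ∈ T, ∀ p ∈ S, χ t p ^ m = 1) {x : A} (hx : x ∈ Submodule.span ℂ (v '' S))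
    (hc : ∀ t ∈ T, Commute x (w t)) :
    x ∈ Submodule.span ℂ (v '' {p ∈ S | ∀ t ∈ T, χ t p = 1}) := by
  classical
  induction T using Finset.induction_on with
  | empty => simpa using hx
  | insert t T _ ih =>
    have h1 := ih (fun t ht => hw t (Finset.mem_insert_of_mem ht))
      (fun t ht => hv t (Finset.mem_insert_of_mem ht))
      (fun t ht => hχ t (Finset.mem_insert_of_mem ht))
      fun t ht => hc t (Finset.mem_insert_of_mem ht)
    have ht := Finset.mem_insert_self t T
    have h2 := mem_span_eigenvalue_one hm (hw t ht) (fun p hp => hv t ht p hp.1)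
      (fun p hp => hχ t ht p hp.1) h1 (hc t ht)
    refine Submodule.span_mono (Set.image_mono ?_) h2
    rintro p ⟨⟨hp, h3⟩, h4⟩
    refine ⟨hp, fun s hs => ?_⟩
    rcases Finset.mem_insert.1 hs with rfl | hs
    · exact h4
    · exact h3 s hs

end Averaging

section Center

variable {N : ℕ} {q : ℂ} {m : ℕ}

theorem signedPow_mem {B : Subalgebra ℂ (Fq q N)} {k : Fin N} (hz : z q k ^ m ∈ B)
    (hzs : zs q k ^ m ∈ B) {n : ℤ} (hn : (m : ℤ) ∣ n) : signedPow q k n ∈ B := by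
  have h1 : m ∣ n.toNat := by
    rcases le_total 0 n with h | h
    · exact Int.natCast_dvd_natCast.1 (by rwa [Int.toNat_of_nonneg h])
    · rw [Int.toNat_of_nonpos h]; exact dvd_zero m
  have h2 : m ∣ (-n).toNat := by
    rcases le_total 0 (-n) with h | h
    · exact Int.natCast_dvd_natCast.1 (by rwa [Int.toNat_of_nonneg h, dvd_neg])
    · rw [Int.toNat_of_nonpos h]; exact dvd_zero m
  obtain ⟨a, ha⟩ := h1
  obtain ⟨b, hb⟩ := h2
  rw [signedPow, ha, hb, pow_mul, pow_mul]
  exact mul_mem (pow_mem hz a) (pow_mem hzs b)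

theorem torusMonomial_qcommute_z (hm : m ≠ 0) (hq : q ^ m = 1) {l j : Fin N} (hl : l.val + 1 = N)
    (hj : j ≠ l) {d : Fin N → ℤ} (hd : ∀ k, k ≠ l → (m : ℤ) ∣ d k) :
    QCommute (q ^ (d l).natAbs) (torusMonomial q d) (z q j) := by
  have hq0 : q ≠ 0 := by rintro rfl; simp [hm] at hq
  have hjl : j < l := lt_of_le_of_ne (Fin.le_def.2 (by omega)) hj
  have h := QCommute.list_prod_left (w := z q j) (List.finRange N)
    (fun k => signedPow q k (d k)) (fun k => if k = l then q ^ (d l).natAbs else 1) (by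
      intro k _
      rcases eq_or_ne k l with rfl | hk
      · rw [if_pos rfl]
        have h := signedPow_qcommute k (d k) (z_qcommute_z' hq0 hjl) (zs_qcommute_z hq0 hjl.ne')
        rw [← pow_add] at h
        convert h using 2
        omega
      · rw [if_neg hk, qcommute_one_iff]
        have h := signedPow_mem (z_pow_mem_center hm hq k) (zs_pow_mem_center hm hq k) (hd k hk)
        exact ((Subalgebra.mem_center_iff.1 h) _).symm)
  rwa [← Fin.prod_univ_def, Finset.prod_ite_eq' Finset.univ l, if_pos (Finset.mem_univ l)] at h

theorem dvd_of_forall_torus_eigenvalue_eq_one (hm : Odd m) (hq : IsPrimitiveRoot q m)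
    {d : Fin N → ℤ}
    (h : ∀ i < N, (∏ k : Fin N, if k.val < i then (q ^ 2) ^ (-d k) else 1) = 1) (k : Fin N)
    (hk : k.val + 1 < N) : (m : ℤ) ∣ d k := by
  have h1 := h _ hk
  have h2 := h k k.2
  rw [← Finset.prod_filter] at h1 h2
  rw [prod_filter_lt_succ, h2, mul_one] at h1
  have hroot := hq.pow_of_coprime 2 hm.coprime_two_left
  exact dvd_neg.1 ((hroot.zpow_eq_one_iff_dvd _).1 h1)

theorem dvd_of_forall_omega_eigenvalue_eq_one (hm : Odd m) (hq : IsPrimitiveRoot q m)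
    {a : Fin N → ℕ} {n : ℕ} (h : ∀ j : Fin N, j.val + 1 < N →
      (∏ k : Fin N, if j < k then (q ^ 2) ^ a k else 1) * q ^ n = 1) (k : Fin N)
    (hk0 : 0 < k.val) (hk : k.val + 1 < N) : m ∣ a k := by
  have h1 := h ⟨k.val - 1, by omega⟩ (by simp; omega)
  have h2 := h k hk
  rw [← Finset.prod_filter] at h1 h2
  have h3 := prod_filter_le_eq_mul (fun k => (q ^ 2) ^ a k) k
  have e1 : ({i : Fin N | (⟨k.val - 1, by omega⟩ : Fin N) < i} : Finset (Fin N)) =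
      ({i : Fin N | k.val ≤ i.val} : Finset (Fin N)) := by
    ext i; simp only [Finset.mem_filter, Finset.mem_univ, true_and, Fin.lt_def]; omega
  have e2 : ({i : Fin N | k < i} : Finset (Fin N)) =
      ({i : Fin N | k.val + 1 ≤ i.val} : Finset (Fin N)) := by
    ext i; simp only [Finset.mem_filter, Finset.mem_univ, true_and, Fin.lt_def]; omega
  rw [e1, h3, mul_assoc, ← e2, h2, mul_one] at h1
  have hroot := hq.pow_of_coprime 2 hm.coprime_two_left
  exact (hroot.pow_eq_one_iff_dvd _).1 h1

theorem dvd_two_mul_add_of_omega_eigenvalue_eq_one (hq : IsPrimitiveRoot q m) {a : Fin N → ℕ}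
    {n : ℕ} {j l : Fin N} (hl : l.val + 1 = N) (hj : j.val + 1 = l.val)
    (h : (∏ k : Fin N, if j < k then (q ^ 2) ^ a k else 1) * q ^ n = 1) :
    m ∣ 2 * a l + n := by
  have e : ({i : Fin N | j < i} : Finset (Fin N)) = {l} := by
    ext i
    simp only [Finset.mem_filter, Finset.mem_univ, true_and, Fin.lt_def, Finset.mem_singleton,
      Fin.ext_iff]
    omega
  rw [← Finset.prod_filter, e, Finset.prod_singleton, ← pow_mul, ← pow_add] at h
  exact (hq.pow_eq_one_iff_dvd _).1 h

variable {B : Subalgebra ℂ (Fq q N)}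

theorem partialOmega_pow_mem (hm : Odd m) (hq : IsPrimitiveRoot q m) (hz : ∀ k, z q k ^ m ∈ B)
    (hzs : ∀ k, zs q k ^ m ∈ B) {i : ℕ} (hi : i ≤ N) : partialOmega q N i ^ m ∈ B := by
  induction hi using Nat.decreasingInduction with
  | self => rw [partialOmega_self, zero_pow hm.pos.ne']; exact zero_mem B
  | of_succ k hk ih =>
    have h := z_pow_mul_zs_pow hm hq ⟨k, hk⟩
    rw [eq_sub_iff_add_eq] at h
    rw [← h]
    exact add_mem (mul_mem (hz _) (hzs _)) ih

theorem z_pow_mul_zs_pow_mem (hm : 0 < m) {l : Fin N} (hz : z q l ^ m ∈ B) (hzs : zs q l ^ m ∈ B)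
    (hmix : ∀ a b, 1 ≤ a → 1 ≤ b → a + b = m → z q l ^ a * zs q l ^ b ∈ B) {a b : ℕ}
    (hab : m ∣ a + b) : z q l ^ a * zs q l ^ b ∈ B := by
  have h : z q l ^ a * zs q l ^ b =
      (z q l ^ m) ^ (a / m) * (z q l ^ (a % m) * zs q l ^ (b % m)) * (zs q l ^ m) ^ (b / m) := by
    rw [← pow_mul, ← pow_mul, ← mul_assoc, ← pow_add, mul_assoc, ← pow_add, Nat.div_add_mod,
      Nat.mod_add_div]
  rw [h]
  refine mul_mem (mul_mem (pow_mem hz _) ?_) (pow_mem hzs _)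
  have ha := Nat.mod_lt a hm
  have hb := Nat.mod_lt b hm
  have hab' : m ∣ a % m + b % m := by
    rw [Nat.dvd_iff_mod_eq_zero] at hab ⊢
    rw [← Nat.add_mod, hab]
  obtain ⟨c, hc⟩ := hab'
  have hc2 : c < 2 := by
    by_contra hcon
    have : m * 2 ≤ m * c := Nat.mul_le_mul_left m (by omega)
    omega
  interval_cases c
  · have h1 : a % m = 0 := by omega
    have h2 : b % m = 0 := by omega
    simp [h1, h2]
  · rw [mul_one] at hc
    exact hmix _ _ (by omega) (by omega) hc

theorem basisMonomial_mem (hm : Odd m) (hq : IsPrimitiveRoot q m) (hΩ : Omega q N ∈ B)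
    (hz : ∀ k, z q k ^ m ∈ B) (hzs : ∀ k, zs q k ^ m ∈ B) {l : Fin N} (hl : l.val + 1 = N)
    (hmix : ∀ a b, 1 ≤ a → 1 ≤ b → a + b = m → z q l ^ a * zs q l ^ b ∈ B)
    {p : (Fin N →₀ ℕ) × (Fin N → ℤ)} (hd : ∀ k, k ≠ l → (m : ℤ) ∣ p.2 k)
    (ha : ∀ k, 0 < k.val → k ≠ l → m ∣ p.1 k) (hal : m ∣ 2 * p.1 l + (p.2 l).natAbs) :
    basisMonomial q p ∈ B := by
  have hq0 : q ≠ 0 := hq.ne_zero hm.pos.ne'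
  obtain ⟨c, -, h⟩ := torusMonomial_eq hq0 p.2 l
  have hcomm := omegaMonomial_commute_partialOmega hq0 (Function.update p.1 l 0) l.val
  rw [basisMonomial, h, mul_smul_comm, omegaMonomial_eq hq0 p.1 l, ← (hcomm.pow_right _).eq,
    mul_assoc, ← mul_assoc (partialOmega q N l ^ p.1 l)]
  refine B.smul_mem (mul_mem ?_ (mul_mem ?_ ?_)) c
  · refine list_prod_mem fun x hx => ?_
    obtain ⟨k, -, rfl⟩ := List.mem_map.1 hx
    rcases eq_or_ne k l with rfl | hk
    · rw [Function.update_self, pow_zero]; exact one_mem B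
    rw [Function.update_of_ne hk]
    rcases Nat.eq_zero_or_pos k.val with h0 | h0
    · rw [h0, partialOmega_zero]
      exact pow_mem hΩ _
    · obtain ⟨t, ht⟩ := ha k h0 hk
      rw [ht, pow_mul]
      exact pow_mem (partialOmega_pow_mem hm hq hz hzs k.2.le) t
  · have hc := z_commute_zs_last (q := q) hl
    have h1 : partialOmega q N l = z q l * zs q l := by
      rw [z_mul_zs, hl, partialOmega_self, sub_zero]
    rw [h1, signedPow, hc.mul_pow, mul_assoc, ← mul_assoc (zs q l ^ _),
      ((hc.symm.pow_pow (p.1 l) (p.2 l).toNat)).eq, mul_assoc, ← mul_assoc, ← pow_add, ← pow_add]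
    refine z_pow_mul_zs_pow_mem hm.pos (hz l) (hzs l) hmix ?_
    convert hal using 1
    omega
  · refine list_prod_mem fun x hx => ?_
    obtain ⟨k, -, rfl⟩ := List.mem_map.1 hx
    refine signedPow_mem (hz k) (hzs k) ?_
    rcases eq_or_ne k l with rfl | hk
    · simp
    · simpa [Function.update_of_ne hk] using hd k hk

/-- A subalgebra containing the listed elements contains the center. -/
theorem center_le (hm : Odd m) (hq : IsPrimitiveRoot q m) (hN : 2 ≤ N) (hΩ : Omega q N ∈ B)
    (hz : ∀ k, z q k ^ m ∈ B) (hzs : ∀ k, zs q k ^ m ∈ B) {l : Fin N} (hl : l.val + 1 = N)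
    (hmix : ∀ a b, 1 ≤ a → 1 ≤ b → a + b = m → z q l ^ a * zs q l ^ b ∈ B) :
    Subalgebra.center ℂ (Fq q N) ≤ B := by
  intro x hx
  have hm0 := hm.pos.ne'
  have hq0 : q ≠ 0 := hq.ne_zero hm0
  have hcomm : ∀ y, Commute x y := fun y => (Subalgebra.mem_center_iff.1 hx y).symm
  have h0 : x ∈ Submodule.span ℂ (basisMonomial q (N := N) '' Set.univ) := by
    rw [Set.image_univ, span_basisMonomial hq0]; trivial
  have h1 := mem_span_forall_eigenvalue_one (w := fun i => partialOmega q N i)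
    (χ := fun i p => ∏ k : Fin N, if k.val < i then (q ^ 2) ^ (-p.2 k) else 1) hm0
    (Finset.range N)
    (fun i hi x => eq_zero_of_partialOmega_mul_eq_zero hq0 (Finset.mem_range.1 hi))
    (fun i _ p _ => by
      have h := (qcommute_one_iff.2 (omegaMonomial_commute_partialOmega hq0 p.1 i)).mul_left
        (torusMonomial_qcommute_partialOmega hq0 p.2 i)
      rwa [one_mul] at h)
    (fun i _ p _ => by
      rw [← Finset.prod_pow]
      refine Finset.prod_eq_one fun k _ => ?_
      split_ifs
      · rw [← zpow_natCast, zpow_comm, zpow_natCast, ← pow_mul, mul_comm, pow_mul, hq.pow_eq_one,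
          one_pow, one_zpow]
      · exact one_pow m) h0 fun i _ => hcomm _
  have hd : ∀ p ∈ {p ∈ (Set.univ : Set ((Fin N →₀ ℕ) × (Fin N → ℤ))) | ∀ i ∈ Finset.range N,
      (∏ k : Fin N, if k.val < i then (q ^ 2) ^ (-p.2 k) else 1) = 1},
      ∀ k, k ≠ l → (m : ℤ) ∣ p.2 k := fun p hp k hk =>
    dvd_of_forall_torus_eigenvalue_eq_one hm hq (fun i hi => hp.2 i (Finset.mem_range.2 hi)) k (by
      have := Fin.val_ne_of_ne hk
      omega)
  have h2 := mem_span_forall_eigenvalue_one (w := fun j : Fin N => z q j)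
    (χ := fun j p => (∏ k : Fin N, if j < k then (q ^ 2) ^ p.1 k else 1) * q ^ (p.2 l).natAbs)
    hm0 {j : Fin N | j ≠ l} (fun j _ x => eq_zero_of_z_mul_eq_zero hq0 j)
    (fun j hj p hp => (omegaMonomial_qcommute_z hq0 p.1 j).mul_left
      (torusMonomial_qcommute_z hm0 hq.pow_eq_one hl (Finset.mem_filter.1 hj).2 (hd p hp)))
    (fun j _ p _ => by
      rw [mul_pow, ← Finset.prod_pow, Finset.prod_eq_one fun k _ => ?_, one_mul, ← pow_mul,
        mul_comm, pow_mul, hq.pow_eq_one, one_pow]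
      split_ifs
      · rw [pow_right_comm, pow_right_comm q, hq.pow_eq_one, one_pow, one_pow]
      · exact one_pow m) h1 fun j _ => hcomm _
  refine (Submodule.span_le (p := Subalgebra.toSubmodule B)).2 ?_ h2
  rintro _ ⟨p, ⟨hp, hp2⟩, rfl⟩
  have hp3 : ∀ j : Fin N, j.val + 1 < N →
      (∏ k : Fin N, if j < k then (q ^ 2) ^ p.1 k else 1) * q ^ (p.2 l).natAbs = 1 :=
    fun j hj => hp2 j (Finset.mem_filter.2 ⟨Finset.mem_univ j, by rintro rfl; omega⟩)
  refine basisMonomial_mem hm hq hΩ hz hzs hl hmix (hd p hp) (fun k hk0 hk => ?_) ?_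
  · refine dvd_of_forall_omega_eigenvalue_eq_one hm hq hp3 k hk0 ?_
    have := Fin.val_ne_of_ne hk
    omega
  · exact dvd_two_mul_add_of_omega_eigenvalue_eq_one hq (j := ⟨N - 2, by omega⟩) hl
      (by simp only; omega) (hp3 _ (by simp only; omega))

end Center

end QuantizedHeisenberg

open QuantizedHeisenberg in
theorem mainTheorem3 (N m : ℕ) (hN : 2 ≤ N) (hm : Odd m) (q : ℂ) (hq : IsPrimitiveRoot q m) :
    Subalgebra.center ℂ (QuantizedHeisenberg.Fq q N) =
      Algebra.adjoin ℂ
        ({QuantizedHeisenberg.Omega q N} ∪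
          {x | ∃ i : Fin N, x = QuantizedHeisenberg.z q i ^ m} ∪
          {x | ∃ i : Fin N, x = QuantizedHeisenberg.zs q i ^ m} ∪
          {x | ∃ a b : ℕ, 1 ≤ a ∧ a ≤ m - 1 ∧ 1 ≤ b ∧ b ≤ m - 1 ∧ a + b = m ∧
            x = QuantizedHeisenberg.z q (⟨N - 1, by omega⟩ : Fin N) ^ a *
              QuantizedHeisenberg.zs q (⟨N - 1, by omega⟩ : Fin N) ^ b}) := by
  have hm0 := hm.pos.ne'
  have hq0 : q ≠ 0 := hq.ne_zero hm0
  have hl : (⟨N - 1, by omega⟩ : Fin N).val + 1 = N := by simp only; omega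
  refine le_antisymm (center_le hm hq hN ?_ (fun k => ?_) (fun k => ?_) hl fun a b ha hb hab => ?_)
    (Algebra.adjoin_le ?_)
  · exact Algebra.subset_adjoin (Or.inl (Or.inl (Or.inl rfl)))
  · exact Algebra.subset_adjoin (Or.inl (Or.inl (Or.inr ⟨k, rfl⟩)))
  · exact Algebra.subset_adjoin (Or.inl (Or.inr ⟨k, rfl⟩))
  · exact Algebra.subset_adjoin
      (Or.inr ⟨a, b, ha, by omega, hb, by omega, hab, rfl⟩)
  · rintro x (((rfl | ⟨i, rfl⟩) | ⟨i, rfl⟩) | ⟨a, b, -, -, -, -, hab, rfl⟩)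
    · exact Omega_mem_center hq0
    · exact z_pow_mem_center hm0 hq.pow_eq_one i
    · exact zs_pow_mem_center hm0 hq.pow_eq_one i
    · exact z_pow_mul_zs_pow_last_mem_center hq0 (hab ▸ hq.pow_eq_one) hl
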